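/- Let $n\ge 1$. (i) Let $K=\mathrm{conv}(0,e_1,\dots,e_n)\subset\mathbb{R}^n$, where $e_1,\dots,e_n$ are the standard unit vectors. Then for every Lipschitz function $f:K\to\mathbb{R}$ with $\int_K f(x)\,dx=0$, $$\int_K f(x)^2\,dx\;\le\;\frac1{n+1}\int_K\Big[\sum_{i=1}^n x_i\,|\partial_i f(x)|^2-\Big(\sum_{i=1}^n x_i\,\partial_i f(x)\Big)^2\Big]dx .$$ (ii) Equivalently, let $\Delta^n=\{(x_0,\dots,x_n)\in\mathbb{R}^{n+1}: x_i>0 \text{ for all } i,\ \sum_{i=0}^n x_i=1\}$, let $dx$ denote the $n$-dimensional volume measure on $\Delta^n$, and for $0\le i,j\le n$ let $E^{ij}f=\big(\frac{\partial}{\partial x_i}-\frac{\partial}{\partial x_j}\big)f$ be the derivative of $f$ in the direction $e_i-e_j$, which is tangent to $\Delta^n$. Then for every Lipschitz function $f:\Delta^n\to\mathbb{R}$ with $\int_{\Delta^n} f(x)\,dx=0$, $$\int_{\Delta^n} f(x)^2\,dx\;\le\;\frac1{n+1}\int_{\Delta^n}\sum_{0\le i<j\le n} x_i x_j\,|E^{ij}f(x)|^2\,dx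 .$$ (The derivatives of a Lipschitz function exist almost everywhere.) -/

import Mathlib

open MeasureTheory

/-- The simplex `K = conv(0, e₁, …, eₙ)` in `ℝⁿ`. -/
def solidSimplex (n : ℕ) : Set (EuclideanSpace ℝ (Fin n)) :=
  convexHull ℝ (insert 0 (Set.range fun i : Fin n => EuclideanSpace.single i (1 : ℝ)))

/-- The (relatively open) regular simplex `Δⁿ` of all `x ∈ ℝⁿ⁺¹` with positive coordinates
`x₀, …, xₙ` whose sum is `1`. -/
def regularSimplex (n : ℕ) : Set (EuclideanSpace ℝ (Fin (n + 1))) :=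
  {x | (∀ i, 0 < x i) ∧ ∑ i, x i = 1}

/-- The partial derivative `∂f/∂xᵢ`, as the derivative of `f` along the line in direction `eᵢ`. -/
noncomputable def partialDeriv {n : ℕ} (i : Fin n) (f : EuclideanSpace ℝ (Fin n) → ℝ)
    (x : EuclideanSpace ℝ (Fin n)) : ℝ :=
  lineDeriv ℝ f x (EuclideanSpace.single i (1 : ℝ))

/-- `Eⁱʲ f = (∂/∂xᵢ - ∂/∂xⱼ) f`, the derivative of `f` in the direction `eᵢ - eⱼ`. This direction
is tangent to `Δⁿ`, so at a point of `Δⁿ` the value depends only on the restriction of `f` to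
`Δⁿ`. -/
noncomputable def tangentDeriv {n : ℕ} (i j : Fin (n + 1))
    (f : EuclideanSpace ℝ (Fin (n + 1)) → ℝ) (p : EuclideanSpace ℝ (Fin (n + 1))) : ℝ :=
  lineDeriv ℝ f p (EuclideanSpace.single i (1 : ℝ) - EuclideanSpace.single j (1 : ℝ))

/-!
For i.i.d. standard exponential variables `y₀, …, yₙ` one has `Var F ≤ E ∑ yᵢ (∂ᵢF)²`. In one
variable, Cauchy–Schwarz on the segment from the mean `1` to `t` bounds `(F t - F 1)²` by
`|t - 1| ∫ (F')²`, and integrating `|t - 1| e⁻ᵗ` over all `t` separated by `u` from `1` gives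
exactly `u e⁻ᵘ`. The Efron–Stein inequality extends this to several variables.

Now let `F` be the extension of a function `g` of mean zero on the simplex that is homogeneous of
degree `1`. The sum `s` of the `yᵢ` has a Gamma distribution and is independent of the proportions
`x`, which are uniform on the simplex. At `y = s x` the energy `∑ yᵢ (∂ᵢF)²` equals `s (g² + Γ(g))`,
where `Γ(g)` is the carré du champ, so the moments of `s` turn the inequality for `F` into
`(n + 2) ∫ g² ≤ ∫ (g² + Γ(g))`. By Lagrange's identity, `Γ(g)` is also the energy in the
directions `eᵢ - eⱼ`, which gives the form on the regular simplex.
-/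

namespace SimplexPoincare

open Filter ProbabilityTheory Set Topology
open scoped ENNReal NNReal

theorem sq_integral_le {α : Type*} [MeasurableSpace α] {μ : Measure α} [IsFiniteMeasure μ]
    {h : α → ℝ} (hh : MemLp h 2 μ) :
    (∫ x, h x ∂μ) ^ 2 ≤ μ.real univ * ∫ x, h x ^ 2 ∂μ := by
  obtain rfl | h0 := eq_zero_or_neZero μ
  · simp
  have hpos : 0 < μ.real univ := measureReal_univ_pos
  have jensen : (⨍ x, h x ∂μ) ^ 2 ≤ ⨍ x, h x ^ 2 ∂μ :=
    (even_two.convexOn_pow (𝕜 := ℝ)).map_average_le (by fun_prop) isClosed_univ (by simp)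
      (hh.integrable one_le_two) hh.integrable_sq
  rw [average_eq, average_eq, smul_eq_mul, smul_eq_mul] at jensen
  calc (∫ x, h x ∂μ) ^ 2 = μ.real univ ^ 2 * ((μ.real univ)⁻¹ * ∫ x, h x ∂μ) ^ 2 := by
        field_simp
    _ ≤ μ.real univ ^ 2 * ((μ.real univ)⁻¹ * ∫ x, h x ^ 2 ∂μ) := by gcongr
    _ = μ.real univ * ∫ x, h x ^ 2 ∂μ := by field_simp

theorem sq_sub_le_mul_lintegral_deriv {g : ℝ → ℝ} {L : ℝ≥0} (hg : LipschitzWith L g) (a b : ℝ) :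
    ENNReal.ofReal ((g b - g a) ^ 2) ≤
      ENNReal.ofReal |b - a| * ∫⁻ u in uIoc a b, ENNReal.ofReal (deriv g u ^ 2) := by
  have : IsFiniteMeasure (volume.restrict (uIoc a b)) := ⟨by simp [uIoc]⟩
  have hderiv : MemLp (deriv g) 2 (volume.restrict (uIoc a b)) :=
    MemLp.of_bound (measurable_deriv g).aestronglyMeasurable L
      (ae_of_all _ fun u => norm_deriv_le_of_lipschitz hg)
  have ftc : |g b - g a| = |∫ u in uIoc a b, deriv g u| := by
    rw [← (hg.lipschitzOnWith (s := uIcc a b)).absolutelyContinuousOnInterval.integral_deriv_eq_sub,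
      intervalIntegral.abs_intervalIntegral_eq]
  have hlen : (volume.restrict (uIoc a b)).real univ = |b - a| := by
    simp [Measure.real, uIoc, max_sub_min_eq_abs]
  rw [← ofReal_integral_eq_lintegral_ofReal hderiv.integrable_sq (ae_of_all _ fun u => sq_nonneg _),
    ← ENNReal.ofReal_mul (abs_nonneg _)]
  gcongr
  rw [← sq_abs, ftc, sq_abs, ← hlen]
  exact sq_integral_le hderiv

theorem lintegral_sq_sub_le {μ : Measure ℝ} [SFinite μ] {g : ℝ → ℝ} {L : ℝ≥0}
    (hg : LipschitzWith L g) (a : ℝ) :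
    ∫⁻ t, ENNReal.ofReal ((g t - g a) ^ 2) ∂μ ≤
      ∫⁻ u, ENNReal.ofReal (deriv g u ^ 2) *
        ∫⁻ t in {t | u ∈ uIoc a t}, ENNReal.ofReal |t - a| ∂μ := by
  have hset : MeasurableSet {p : ℝ × ℝ | p.2 ∈ uIoc a p.1} :=
    (measurableSet_lt (f := fun p : ℝ × ℝ => min a p.1) (by fun_prop) measurable_snd).inter
      (measurableSet_le (g := fun p : ℝ × ℝ => max a p.1) measurable_snd (by fun_prop))
  have : Measurable fun p : ℝ × ℝ => deriv g p.2 :=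
    (measurable_deriv g).comp measurable_snd
  let k : ℝ × ℝ → ℝ≥0∞ := {p : ℝ × ℝ | p.2 ∈ uIoc a p.1}.indicator fun p =>
    ENNReal.ofReal (deriv g p.2 ^ 2) * ENNReal.ofReal |p.1 - a|
  have hk : Measurable k := Measurable.indicator (by fun_prop) hset
  calc ∫⁻ t, ENNReal.ofReal ((g t - g a) ^ 2) ∂μ
      ≤ ∫⁻ t, (∫⁻ u, k (t, u)) ∂μ := by
        refine lintegral_mono fun t => (sq_sub_le_mul_lintegral_deriv hg a t).trans_eq ?_
        rw [mul_comm, ← lintegral_mul_const _ (by fun_prop),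
          ← lintegral_indicator measurableSet_uIoc]
        rfl
    _ = ∫⁻ u, ∫⁻ t, k (t, u) ∂μ :=
        lintegral_lintegral_swap (f := fun t u => k (t, u)) hk.aemeasurable
    _ = _ := by
        refine lintegral_congr fun u => ?_
        have hu : MeasurableSet {t | u ∈ uIoc a t} := measurable_prodMk_right hset
        rw [← lintegral_const_mul _ (by fun_prop), ← lintegral_indicator hu]
        rfl

/-! ### The exponential distribution -/

theorem gammaMeasure_natCast_add_one (n : ℕ) :
    gammaMeasure (n + 1) 1 = (volume.restrict (Ioi 0)).withDensity fun t =>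
      ENNReal.ofReal (t ^ n / n.factorial * Real.exp (-t)) := by
  rw [gammaMeasure, ← withDensity_indicator measurableSet_Ioi]
  refine withDensity_congr_ae ?_
  filter_upwards [Measure.ae_ne volume 0] with t ht
  obtain h | h := ht.lt_or_gt
  · simp [gammaPDF_of_neg h, h.le]
  · simp [gammaPDF_of_nonneg h.le, h, Real.Gamma_nat_eq_factorial, div_eq_inv_mul]

theorem expMeasure_one :
    expMeasure 1 =
      (volume.restrict (Ioi 0)).withDensity fun t => ENNReal.ofReal (Real.exp (-t)) := by
  simpa [expMeasure] using gammaMeasure_natCast_add_one 0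

instance (n : ℕ) : IsProbabilityMeasure (gammaMeasure (n + 1) 1) :=
  isProbabilityMeasure_gammaMeasure (by positivity) one_pos

instance : IsProbabilityMeasure (expMeasure 1) := isProbabilityMeasure_expMeasure one_pos

theorem ae_pos_expMeasure : ∀ᵐ t ∂expMeasure 1, 0 < t := by
  rw [expMeasure_one]
  exact (withDensity_absolutelyContinuous _ _).ae_le (ae_restrict_mem measurableSet_Ioi)

theorem setLIntegral_expMeasure {s : Set ℝ} (hs : MeasurableSet s) {h : ℝ → ℝ≥0∞}
    (hh : Measurable h) :
    ∫⁻ t in s, h t ∂expMeasure 1 = ∫⁻ t in s ∩ Ioi 0, ENNReal.ofReal (Real.exp (-t)) * h t := by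
  rw [expMeasure_one, setLIntegral_withDensity_eq_setLIntegral_mul _ (by fun_prop) hh hs,
    Measure.restrict_restrict hs]
  rfl

theorem integrableOn_pow_mul_exp_neg (k : ℕ) :
    IntegrableOn (fun t : ℝ => t ^ k * Real.exp (-t)) (Ioi 0) :=
  (Real.GammaIntegral_convergent (s := (k : ℝ) + 1) (by positivity)).congr_fun
    (fun t _ => by simp [mul_comm]) measurableSet_Ioi

theorem integral_pow_mul_exp_neg (k : ℕ) :
    ∫ t in Ioi 0, t ^ k * Real.exp (-t) = k.factorial := by
  rw [← Real.Gamma_nat_eq_factorial, Real.Gamma_eq_integral (by positivity)]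
  exact setIntegral_congr_fun measurableSet_Ioi fun t _ => by simp [mul_comm]

theorem gammaDensity_smul_pow (n k : ℕ) {t : ℝ} (ht : t ∈ Ioi 0) :
    (ENNReal.ofReal (t ^ n / n.factorial * Real.exp (-t))).toReal • t ^ k =
      (n.factorial : ℝ)⁻¹ * (t ^ (n + k) * Real.exp (-t)) := by
  have : 0 < t := ht
  rw [ENNReal.toReal_ofReal (by positivity), smul_eq_mul]
  ring

theorem integrable_pow_gammaMeasure (n k : ℕ) :
    Integrable (fun t => t ^ k) (gammaMeasure (n + 1) 1) := by
  rw [gammaMeasure_natCast_add_one, integrable_withDensity_iff_integrable_smul' (by fun_prop)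
    (by simp)]
  exact IntegrableOn.congr_fun ((integrableOn_pow_mul_exp_neg (n + k)).const_mul _)
    (fun t ht => (gammaDensity_smul_pow n k ht).symm) measurableSet_Ioi

theorem integral_pow_gammaMeasure (n k : ℕ) :
    ∫ t, t ^ k ∂gammaMeasure (n + 1) 1 = (n + k).factorial / n.factorial := by
  rw [gammaMeasure_natCast_add_one, integral_withDensity_eq_integral_toReal_smul (by fun_prop)
      (by simp), setIntegral_congr_fun measurableSet_Ioi fun t => gammaDensity_smul_pow n k,
    integral_const_mul, integral_pow_mul_exp_neg]
  ring

theorem memLp_id_expMeasure : MemLp id 2 (expMeasure 1) := by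
  rw [memLp_two_iff_integrable_sq (by fun_prop)]
  simpa [expMeasure] using integrable_pow_gammaMeasure 0 2

theorem lintegral_Ioi_exp_neg_mul_abs_sub_one {u : ℝ} (hu : 1 ≤ u) :
    ∫⁻ t in Ioi u, ENNReal.ofReal (Real.exp (-t) * |t - 1|) =
      ENNReal.ofReal (u * Real.exp (-u)) := by
  have hderiv : ∀ t ∈ Ici u,
      HasDerivAt (fun t => -(t * Real.exp (-t))) (Real.exp (-t) * |t - 1|) t := fun t ht => by
    convert! ((hasDerivAt_id t).mul (hasDerivAt_neg t).exp).neg using 1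
    rw [abs_of_nonneg (by linarith [mem_Ici.1 ht])]
    simp only [id]
    ring
  have hlim : Tendsto (fun t : ℝ => -(t * Real.exp (-t))) atTop (𝓝 0) := by
    simpa using (Real.tendsto_pow_mul_exp_neg_atTop_nhds_zero 1).neg
  have hpos : ∀ t ∈ Ioi u, 0 ≤ Real.exp (-t) * |t - 1| := fun t _ => by positivity
  rw [← ofReal_integral_eq_lintegral_ofReal
    (integrableOn_Ioi_deriv_of_nonneg' hderiv hpos hlim) (ae_of_all _ fun t => by positivity),
    integral_Ioi_of_hasDerivAt_of_nonneg' hderiv hpos hlim]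
  simp

theorem lintegral_Ioc_exp_neg_mul_abs_sub_one {u : ℝ} (hu0 : 0 ≤ u) (hu1 : u ≤ 1) :
    ∫⁻ t in Ioc 0 u, ENNReal.ofReal (Real.exp (-t) * |t - 1|) =
      ENNReal.ofReal (u * Real.exp (-u)) := by
  have hderiv : ∀ t ∈ uIcc 0 u,
      HasDerivAt (fun t => t * Real.exp (-t)) (Real.exp (-t) * |t - 1|) t := fun t ht => by
    rw [uIcc_of_le hu0] at ht
    convert! (hasDerivAt_id t).mul (hasDerivAt_neg t).exp using 1
    rw [abs_of_nonpos (by linarith [ht.2])]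
    simp only [id]
    ring
  have hcont : Continuous fun t : ℝ => Real.exp (-t) * |t - 1| := by fun_prop
  rw [← ofReal_integral_eq_lintegral_ofReal hcont.integrableOn_Ioc
      (ae_of_all _ fun t => by positivity), ← intervalIntegral.integral_of_le hu0,
    intervalIntegral.integral_eq_sub_of_hasDerivAt hderiv (hcont.intervalIntegrable _ _)]
  simp

/- The Stein kernel of the exponential distribution with respect to its mean `1` is the identity;
the truncation of `u` at `0` accounts for the absence of mass there. -/
theorem lintegral_abs_sub_one_expMeasure (u : ℝ) :
    ∫⁻ t in {t | u ∈ uIoc 1 t}, ENNReal.ofReal |t - 1| ∂expMeasure 1 =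
      (Ioi 0).indicator (fun u => ENNReal.ofReal (Real.exp (-u)) * ENNReal.ofReal u) u := by
  have hmul (t : ℝ) : ENNReal.ofReal (Real.exp (-t)) * ENNReal.ofReal |t - 1| =
      ENNReal.ofReal (Real.exp (-t) * |t - 1|) := (ENNReal.ofReal_mul (by positivity)).symm
  obtain hu1 | hu1 := lt_or_ge 1 u
  · have hset : {t | u ∈ uIoc 1 t} = Ici u := by
      ext t
      simp [mem_uIoc, hu1, hu1.not_ge]
    have h0 : (0 : ℝ) < u := by linarith
    rw [hset, setLIntegral_expMeasure measurableSet_Ici (by fun_prop),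
      inter_eq_left.2 (Ici_subset_Ioi.2 h0), setLIntegral_congr Ioi_ae_eq_Ici.symm]
    simp only [hmul, lintegral_Ioi_exp_neg_mul_abs_sub_one hu1.le, indicator_of_mem (mem_Ioi.2 h0)]
    rw [← ENNReal.ofReal_mul (by positivity), mul_comm]
  · have hset : {t | u ∈ uIoc 1 t} = Iio u := by
      ext t
      simp [mem_uIoc, hu1, hu1.not_gt]
    rw [hset, setLIntegral_expMeasure measurableSet_Iio (by fun_prop), Iio_inter_Ioi,
      setLIntegral_congr Ioo_ae_eq_Ioc]
    obtain hu0 | hu0 := lt_or_ge 0 u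
    · simp only [hmul, lintegral_Ioc_exp_neg_mul_abs_sub_one hu0.le hu1,
        indicator_of_mem (mem_Ioi.2 hu0)]
      rw [← ENNReal.ofReal_mul (by positivity), mul_comm]
    · simp [hu0]

theorem memLp_of_lipschitzWith {E : Type*} [NormedAddCommGroup E] [MeasurableSpace E]
    {μ : Measure E} [IsFiniteMeasure μ] {p : ℝ≥0∞} (hμ : MemLp id p μ) {f : E → ℝ} {L : ℝ≥0}
    (hf : LipschitzWith L f) : MemLp f p μ := by
  have hsub : MemLp (fun x => f x - f 0) p μ :=
    (hf.sub (.const (f 0))).comp_memLp (by simp) hμ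
  simpa [Pi.add_def] using hsub.add (memLp_const (f 0))

theorem integrable_mul_sq_of_norm_le {α : Type*} [MeasurableSpace α] {μ : Measure α} {w h : α → ℝ}
    {C : ℝ} (hw : Integrable w μ) (hm : AEStronglyMeasurable h μ) (hh : ∀ x, ‖h x‖ ≤ C) :
    Integrable (fun x => w x * h x ^ 2) μ :=
  hw.mul_bdd (c := C ^ 2) (hm.pow 2) (ae_of_all _ fun x => by rw [norm_pow]; gcongr; exact hh x)

theorem variance_expMeasure_le {g : ℝ → ℝ} {L : ℝ≥0} (hg : LipschitzWith L g) :
    Var[g; expMeasure 1] ≤ ∫ t, t * deriv g t ^ 2 ∂expMeasure 1 := by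
  have hmeas : AEStronglyMeasurable g (expMeasure 1) := hg.continuous.aestronglyMeasurable
  have hint : Integrable (fun t => t * deriv g t ^ 2) (expMeasure 1) :=
    integrable_mul_sq_of_norm_le (memLp_id_expMeasure.integrable one_le_two)
      (measurable_deriv g).aestronglyMeasurable fun t => norm_deriv_le_of_lipschitz hg
  have hnonneg : 0 ≤ᵐ[expMeasure 1] fun t => t * deriv g t ^ 2 :=
    ae_pos_expMeasure.mono fun t ht => mul_nonneg ht.le (sq_nonneg _)
  have hkernel : ∫⁻ t, ENNReal.ofReal ((g t - g 1) ^ 2) ∂expMeasure 1 ≤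
      ∫⁻ t, ENNReal.ofReal (t * deriv g t ^ 2) ∂expMeasure 1 :=
    calc ∫⁻ t, ENNReal.ofReal ((g t - g 1) ^ 2) ∂expMeasure 1
        ≤ _ := lintegral_sq_sub_le hg 1
      _ = ∫⁻ t in Ioi 0, ENNReal.ofReal (Real.exp (-t)) * ENNReal.ofReal (t * deriv g t ^ 2) := by
        rw [← lintegral_indicator measurableSet_Ioi]
        refine lintegral_congr fun t => ?_
        rw [lintegral_abs_sub_one_expMeasure]
        by_cases ht : 0 < t
        · simp only [indicator_of_mem (mem_Ioi.2 ht), ENNReal.ofReal_mul ht.le]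
          ring
        · simp [ht]
      _ = _ := by
        rw [← Measure.restrict_univ (μ := expMeasure 1),
          setLIntegral_expMeasure .univ (by fun_prop), univ_inter]
  rw [← variance_sub_const hmeas (g 1)]
  refine (variance_le_expectation_sq (hmeas.sub aestronglyMeasurable_const)).trans ?_
  refine (ENNReal.ofReal_le_ofReal_iff (integral_nonneg_of_ae hnonneg)).1 ?_
  have hsub : MemLp (fun t => g t - g 1) 2 (expMeasure 1) :=
    (memLp_of_lipschitzWith memLp_id_expMeasure hg).sub (memLp_const (g 1))
  rwa [← ofReal_integral_eq_lintegral_ofReal hsub.integrable_sq (ae_of_all _ fun t => sq_nonneg _),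
    ← ofReal_integral_eq_lintegral_ofReal hint hnonneg] at hkernel

/-! ### Tensorization -/

section Product

variable {α β : Type*} [MeasurableSpace α] [MeasurableSpace β] {μ : Measure α} {ν : Measure β}
  {G : α × β → ℝ}

theorem memLp_prodMk_left [SFinite μ] [SFinite ν] (hG : MemLp G 2 (μ.prod ν)) :
    ∀ᵐ x ∂μ, MemLp (fun y => G (x, y)) 2 ν := by
  filter_upwards [hG.1.prodMk_left, hG.integrable_sq.prod_right_ae] with x hmeas hsq
  exact (memLp_two_iff_integrable_sq hmeas).2 hsq

variable [IsProbabilityMeasure μ] [IsProbabilityMeasure ν]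

theorem memLp_integral_prodMk_left (hG : MemLp G 2 (μ.prod ν)) :
    MemLp (fun x => ∫ y, G (x, y) ∂ν) 2 μ := by
  have hmeas : AEStronglyMeasurable (fun x => ∫ y, G (x, y) ∂ν) μ := hG.1.integral_prod_right'
  refine (memLp_two_iff_integrable_sq hmeas).2
    (hG.integrable_sq.integral_prod_left.mono' (hmeas.pow 2) ?_)
  filter_upwards [memLp_prodMk_left hG] with x hx
  rw [Real.norm_of_nonneg (sq_nonneg _)]
  simpa using sq_integral_le hx

theorem variance_prodMk_left_ae_eq (hG : MemLp G 2 (μ.prod ν)) :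
    (fun x => Var[fun y => G (x, y); ν]) =ᵐ[μ]
      fun x => ∫ y, G (x, y) ^ 2 ∂ν - (∫ y, G (x, y) ∂ν) ^ 2 :=
  (memLp_prodMk_left hG).mono fun _ hx => variance_eq_sub hx

theorem integrable_variance_prodMk_left (hG : MemLp G 2 (μ.prod ν)) :
    Integrable (fun x => Var[fun y => G (x, y); ν]) μ :=
  (hG.integrable_sq.integral_prod_left.sub
    (memLp_integral_prodMk_left hG).integrable_sq).congr (variance_prodMk_left_ae_eq hG).symm

theorem integrable_variance_prodMk_right (hG : MemLp G 2 (μ.prod ν)) :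
    Integrable (fun y => Var[fun x => G (x, y); μ]) ν :=
  integrable_variance_prodMk_left (G := G ∘ Prod.swap)
    (hG.comp_measurePreserving Measure.measurePreserving_swap)

theorem variance_prod (hG : MemLp G 2 (μ.prod ν)) :
    Var[G; μ.prod ν] =
      ∫ x, Var[fun y => G (x, y); ν] ∂μ + Var[fun x => ∫ y, G (x, y) ∂ν; μ] := by
  have hmean := memLp_integral_prodMk_left hG
  rw [integral_congr_ae (variance_prodMk_left_ae_eq hG),
    integral_sub hG.integrable_sq.integral_prod_left hmean.integrable_sq, variance_eq_sub hmean,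
    variance_eq_sub hG, integral_prod _ (hG.integrable one_le_two)]
  simp only [Pi.pow_apply]
  rw [integral_prod _ hG.integrable_sq]
  ring

theorem variance_integral_le (hG : MemLp G 2 (μ.prod ν)) :
    Var[fun x => ∫ y, G (x, y) ∂ν; μ] ≤ ∫ y, Var[fun x => G (x, y); μ] ∂ν := by
  let H : α × β → ℝ := fun p => G p - ∫ x, G (x, p.2) ∂μ
  have hswap : MemLp (fun p : β × α => G p.swap) 2 (ν.prod μ) :=
    hG.comp_measurePreserving Measure.measurePreserving_swap
  have hmean : MemLp (fun y => ∫ x, G (x, y) ∂μ) 2 ν := memLp_integral_prodMk_left hswap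
  have hH : MemLp H 2 (μ.prod ν) :=
    hG.sub (hmean.comp_measurePreserving measurePreserving_snd)
  have hb := memLp_integral_prodMk_left hG
  have hcenter : ∫ x, ∫ y, G (x, y) ∂ν ∂μ = ∫ y, ∫ x, G (x, y) ∂μ ∂ν :=
    integral_integral_swap (f := fun x y => G (x, y)) (hG.integrable one_le_two)
  calc Var[fun x => ∫ y, G (x, y) ∂ν; μ]
      = ∫ x, (∫ y, H (x, y) ∂ν) ^ 2 ∂μ := by
        rw [variance_eq_integral hb.1.aemeasurable, hcenter]
        refine integral_congr_ae ?_
        filter_upwards [memLp_prodMk_left hG] with x hx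
        rw [integral_sub (hx.integrable one_le_two) (hmean.integrable one_le_two)]
    _ ≤ ∫ x, ∫ y, H (x, y) ^ 2 ∂ν ∂μ := by
        refine integral_mono_ae (memLp_integral_prodMk_left hH).integrable_sq
          hH.integrable_sq.integral_prod_left ?_
        filter_upwards [memLp_prodMk_left hH] with x hx
        simpa using sq_integral_le hx
    _ = ∫ y, ∫ x, H (x, y) ^ 2 ∂μ ∂ν :=
        integral_integral_swap (f := fun x y => H (x, y) ^ 2) hH.integrable_sq
    _ = ∫ y, Var[fun x => G (x, y); μ] ∂ν := by
        refine integral_congr_ae ?_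
        filter_upwards [memLp_prodMk_left hswap] with y hy
        exact (variance_eq_integral hy.1.aemeasurable).symm

theorem variance_prod_le (hG : MemLp G 2 (μ.prod ν)) :
    Var[G; μ.prod ν] ≤
      ∫ y, Var[fun x => G (x, y); μ] ∂ν + ∫ x, Var[fun y => G (x, y); ν] ∂μ := by
  rw [variance_prod hG, add_comm]
  gcongr
  exact variance_integral_le hG

end Product

/-- `Fin.cons` as a continuous linear equivalence between `ℝ × ℝⁿ` and `ℝⁿ⁺¹`. -/
noncomputable def consCLE (n : ℕ) : (ℝ × (Fin n → ℝ)) ≃L[ℝ] (Fin (n + 1) → ℝ) :=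
  Fin.consEquivL ℝ fun _ => ℝ

@[simp]
theorem consCLE_zero {n : ℕ} (p : ℝ × (Fin n → ℝ)) : consCLE n p 0 = p.1 := rfl

@[simp]
theorem consCLE_succ {n : ℕ} (p : ℝ × (Fin n → ℝ)) (i : Fin n) : consCLE n p i.succ = p.2 i := rfl

theorem measurePreserving_consCLE (n : ℕ) (μ : Measure ℝ) [SigmaFinite μ] :
    MeasurePreserving (consCLE n) (μ.prod (Measure.pi fun _ => μ)) (Measure.pi fun _ => μ) := by
  convert! (measurePreserving_piFinSuccAbove (fun _ : Fin (n + 1) => μ) 0).symm using 1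
  ext p i
  refine Fin.cases ?_ (fun i => ?_) i <;> simp [MeasurableEquiv.piFinSuccAbove]

theorem lineDeriv_consCLE_zero {n : ℕ} (f : (Fin (n + 1) → ℝ) → ℝ) (p : ℝ × (Fin n → ℝ)) :
    lineDeriv ℝ f (consCLE n p) (Pi.single 0 1) = deriv (fun u => f (consCLE n (u, p.2))) p.1 := by
  have hline (u : ℝ) : consCLE n p + u • Pi.single 0 1 = consCLE n (p.1 + u, p.2) := by
    ext i
    refine Fin.cases ?_ (fun i => ?_) i <;> simp
  simp only [lineDeriv, hline]
  rw [deriv_comp_const_add (f := fun u => f (consCLE n (u, p.2))) p.1 0, add_zero]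

theorem lineDeriv_consCLE_succ {n : ℕ} (f : (Fin (n + 1) → ℝ) → ℝ) (p : ℝ × (Fin n → ℝ))
    (i : Fin n) :
    lineDeriv ℝ f (consCLE n p) (Pi.single i.succ 1) =
      lineDeriv ℝ (fun z => f (consCLE n (p.1, z))) p.2 (Pi.single i 1) := by
  have hline (u : ℝ) : consCLE n p + u • Pi.single i.succ 1 =
      consCLE n (p.1, p.2 + u • Pi.single i 1) := by
    ext j
    refine Fin.cases ?_ (fun j => ?_) j <;> simp [Pi.single_apply]
  simp only [lineDeriv, hline]

theorem memLp_id_pi {n : ℕ} {μ : Measure ℝ} [IsProbabilityMeasure μ] (hμ : MemLp id 2 μ) :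
    MemLp id 2 (Measure.pi fun _ : Fin n => μ) :=
  MemLp.of_eval fun i => hμ.comp_measurePreserving (measurePreserving_eval (fun _ => μ) i)

theorem integrable_eval_mul_lineDeriv_sq {n : ℕ} {μ : Measure ℝ} [IsProbabilityMeasure μ]
    {w : ℝ → ℝ} (hw : Integrable w μ) {f : (Fin n → ℝ) → ℝ} {L : ℝ≥0} (hf : LipschitzWith L f)
    (i : Fin n) (v : Fin n → ℝ) :
    Integrable (fun y => w (y i) * lineDeriv ℝ f y v ^ 2) (Measure.pi fun _ => μ) :=
  integrable_mul_sq_of_norm_le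
    ((measurePreserving_eval (fun _ => μ) i).integrable_comp_of_integrable hw)
    (measurable_lineDeriv hf.continuous).aestronglyMeasurable
    fun _ => norm_lineDeriv_le_of_lipschitz ℝ hf

theorem variance_pi_le {μ : Measure ℝ} [IsProbabilityMeasure μ] {w : ℝ → ℝ} (hμ : MemLp id 2 μ)
    (hw : Integrable w μ)
    (poincare : ∀ (g : ℝ → ℝ) (L : ℝ≥0), LipschitzWith L g →
      Var[g; μ] ≤ ∫ t, w t * deriv g t ^ 2 ∂μ)
    {n : ℕ} {f : (Fin n → ℝ) → ℝ} {L : ℝ≥0} (hf : LipschitzWith L f) :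
    Var[f; Measure.pi fun _ => μ] ≤
      ∫ y, ∑ i, w (y i) * lineDeriv ℝ f y (Pi.single i 1) ^ 2 ∂Measure.pi fun _ => μ := by
  induction n generalizing L with
  | zero => simp [Measure.pi_of_empty (fun _ : Fin 0 => μ) 0]
  | succ n ih =>
    let π := Measure.pi fun _ : Fin n => μ
    have he : MeasurePreserving (consCLE n) (μ.prod π) (Measure.pi fun _ => μ) :=
      measurePreserving_consCLE n μ
    let G : ℝ × (Fin n → ℝ) → ℝ := f ∘ consCLE n
    have hLip := hf.comp (consCLE n).lipschitz
    have hG : MemLp G 2 (μ.prod π) :=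
      (memLp_of_lipschitzWith (memLp_id_pi hμ) hf).comp_measurePreserving he
    have hint (i : Fin (n + 1)) :=
      he.integrable_comp_of_integrable (integrable_eval_mul_lineDeriv_sq hw hf i (Pi.single i 1))
    have hint_fst : Integrable (fun p : ℝ × (Fin n → ℝ) =>
        w p.1 * deriv (fun u => G (u, p.2)) p.1 ^ 2) (μ.prod π) :=
      (hint 0).congr (ae_of_all _ fun p => by simp [G, lineDeriv_consCLE_zero])
    have hint_snd : Integrable (fun p : ℝ × (Fin n → ℝ) => ∑ i,
        w (p.2 i) * lineDeriv ℝ (fun z => G (p.1, z)) p.2 (Pi.single i 1) ^ 2) (μ.prod π) :=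
      integrable_finsetSum _ fun i _ =>
        (hint i.succ).congr (ae_of_all _ fun p => by simp [G, lineDeriv_consCLE_succ])
    have hvar_fst : ∫ y, Var[fun t => G (t, y); μ] ∂π ≤
        ∫ y, ∫ t, w t * deriv (fun u => G (u, y)) t ^ 2 ∂μ ∂π :=
      integral_mono (integrable_variance_prodMk_right hG) hint_fst.integral_prod_right
        fun y => poincare _ _ (hLip.comp (LipschitzWith.prodMk_right y))
    have hvar_snd : ∫ t, Var[fun y => G (t, y); π] ∂μ ≤ ∫ t, ∫ y, ∑ i,
        w (y i) * lineDeriv ℝ (fun z => G (t, z)) y (Pi.single i 1) ^ 2 ∂π ∂μ :=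
      integral_mono (integrable_variance_prodMk_left hG) hint_snd.integral_prod_left
        fun t => ih (hLip.comp (LipschitzWith.prodMk_left t))
    rw [← he.variance_fun_comp hf.continuous.aemeasurable]
    refine ((variance_prod_le hG).trans (add_le_add hvar_fst hvar_snd)).trans_eq ?_
    rw [← integral_prod_symm _ hint_fst, ← integral_prod _ hint_snd,
      ← integral_add hint_fst hint_snd,
      ← he.integral_comp (consCLE n).toHomeomorph.measurableEmbedding]
    simp [G, Fin.sum_univ_succ, lineDeriv_consCLE_zero, lineDeriv_consCLE_succ]

theorem variance_pi_expMeasure_le {n : ℕ} {f : (Fin n → ℝ) → ℝ} {L : ℝ≥0}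
    (hf : LipschitzWith L f) :
    Var[f; Measure.pi fun _ => expMeasure 1] ≤
      ∫ y, ∑ i, y i * lineDeriv ℝ f y (Pi.single i 1) ^ 2 ∂Measure.pi fun _ => expMeasure 1 :=
  variance_pi_le memLp_id_expMeasure (memLp_id_expMeasure.integrable one_le_two)
    (fun _ _ => variance_expMeasure_le) hf

/-! ### Independence of sum and proportions -/

theorem pi_withDensity {μ : Measure ℝ} [SigmaFinite μ] {f : ℝ → ℝ≥0∞}
    [SigmaFinite (μ.withDensity f)] (hf : Measurable f) (n : ℕ) :
    Measure.pi (fun _ : Fin n => μ.withDensity f) =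
      (Measure.pi fun _ => μ).withDensity fun y => ∏ i, f (y i) := by
  induction n with
  | zero => simp [Measure.pi_of_empty _ (0 : Fin 0 → ℝ)]
  | succ n ih =>
    refine Measure.ext_of_lintegral _ fun H hH => ?_
    have hprod : Measurable fun y : Fin (n + 1) → ℝ => ∏ i, f (y i) := by fun_prop
    rw [lintegral_withDensity_eq_lintegral_mul _ hprod hH,
      ← (measurePreserving_consCLE n (μ.withDensity f)).lintegral_comp hH,
      ← (measurePreserving_consCLE n μ).lintegral_comp (hprod.mul hH), ih,
      prod_withDensity hf (by fun_prop), lintegral_withDensity_eq_lintegral_mul _ (by fun_prop)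
        (by fun_prop)]
    simp [Fin.prod_univ_succ]

theorem lintegral_pi_expMeasure {n : ℕ} {H : (Fin n → ℝ) → ℝ≥0∞} (hH : Measurable H) :
    ∫⁻ y, H y ∂Measure.pi (fun _ => expMeasure 1) =
      ∫⁻ y in univ.pi fun _ => Ioi 0, ENNReal.ofReal (Real.exp (-∑ i, y i)) * H y := by
  have hdensity (y : Fin n → ℝ) :
      ∏ i, ENNReal.ofReal (Real.exp (-y i)) = ENNReal.ofReal (Real.exp (-∑ i, y i)) := by
    rw [← ENNReal.ofReal_prod_of_nonneg fun i _ => Real.exp_nonneg _, ← Real.exp_sum,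
      Finset.sum_neg_distrib]
  have : SigmaFinite
      ((volume.restrict (Ioi 0)).withDensity fun t => ENNReal.ofReal (Real.exp (-t))) :=
    expMeasure_one ▸ inferInstance
  simp only [expMeasure_one]
  rw [pi_withDensity (by fun_prop), ← Measure.restrict_pi_pi,
    lintegral_withDensity_eq_lintegral_mul _ (by fun_prop) hH, volume_pi]
  simp [hdensity]

section Cone

variable {E : Type*} [NormedAddCommGroup E] [NormedSpace ℝ E]

/-- The open convex cone in `ℝ × E` spanned by the slice `{1} × A`. -/
def coneOver (A : Set E) : Set (ℝ × E) := {p | 0 < p.1 ∧ p.1⁻¹ • p.2 ∈ A}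

theorem measurableSet_coneOver [MeasurableSpace E] [BorelSpace E] [SecondCountableTopology E]
    {A : Set E} (hA : MeasurableSet A) : MeasurableSet (coneOver A) :=
  (measurableSet_lt measurable_const measurable_fst).inter
    ((measurable_fst.inv.smul measurable_snd) hA)

variable [MeasurableSpace E] [BorelSpace E] [FiniteDimensional ℝ E] {μ : Measure E}
  [μ.IsAddHaarMeasure]

theorem lintegral_eq_mul_lintegral_comp_smul {s : ℝ} (hs : 0 < s) (Φ : E → ℝ≥0∞) :
    ∫⁻ z, Φ z ∂μ = ENNReal.ofReal (s ^ Module.finrank ℝ E) * ∫⁻ x, Φ (s • x) ∂μ := by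
  have hpow : 0 < s ^ Module.finrank ℝ E := by positivity
  rw [← (measurableEmbedding_const_smul₀ hs.ne').lintegral_map, Measure.map_addHaar_smul μ hs.ne',
    lintegral_smul_measure, smul_eq_mul, ← mul_assoc, ← ENNReal.ofReal_mul hpow.le,
    abs_of_pos (inv_pos.2 hpow), mul_inv_cancel₀ hpow.ne', ENNReal.ofReal_one, one_mul]

theorem setLIntegral_coneOver {A : Set E} (hA : MeasurableSet A) {H : ℝ × E → ℝ≥0∞}
    (hH : Measurable H) :
    ∫⁻ p in coneOver A, H p ∂(volume.prod μ) =
      ∫⁻ s in Ioi 0, ENNReal.ofReal (s ^ Module.finrank ℝ E) *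
        ∫⁻ x in A, H (s, s • x) ∂μ := by
  have hcone := measurableSet_coneOver hA
  rw [← lintegral_indicator hcone, ← lintegral_indicator measurableSet_Ioi,
    lintegral_prod _ (hH.indicator hcone).aemeasurable]
  refine lintegral_congr fun s => ?_
  by_cases hs : 0 < s
  · have hmem (x : E) : (s, s • x) ∈ coneOver A ↔ x ∈ A := by
      simp [coneOver, hs, inv_smul_smul₀ hs.ne']
    rw [indicator_of_mem (mem_Ioi.2 hs), lintegral_eq_mul_lintegral_comp_smul hs,
      ← lintegral_indicator hA]
    congr! 3 with x
    by_cases hx : x ∈ A <;> simp [hmem, hx]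
  · simp [coneOver, hs]

end Cone

/-- The linear isomorphism `(s, z) ↦ (s - ∑ zᵢ, z)` of `ℝ × ℝⁿ` with `ℝⁿ⁺¹`. Its inverse sends `y`
to the sum of its coordinates and its tail. -/
noncomputable def ofSumTail (n : ℕ) : (ℝ × (Fin n → ℝ)) ≃L[ℝ] (Fin (n + 1) → ℝ) :=
  LinearEquiv.toContinuousLinearEquiv
    { toFun p := consCLE n (p.1 - ∑ i, p.2 i, p.2)
      invFun y := (∑ i, y i, Fin.tail y)
      map_add' p q := by
        rw [← map_add]
        simp [Finset.sum_add_distrib, add_sub_add_comm]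
      map_smul' c p := by
        rw [← map_smul]
        simp [Finset.mul_sum, mul_sub]
      left_inv p := by
        ext i <;> simp [Fin.sum_univ_succ, Fin.tail]
      right_inv y := by
        ext i
        refine Fin.cases ?_ (fun i => ?_) i <;> simp [Fin.sum_univ_succ, Fin.tail] }

@[simp]
theorem ofSumTail_zero {n : ℕ} (p : ℝ × (Fin n → ℝ)) : ofSumTail n p 0 = p.1 - ∑ i, p.2 i := rfl

@[simp]
theorem ofSumTail_succ {n : ℕ} (p : ℝ × (Fin n → ℝ)) (i : Fin n) :
    ofSumTail n p i.succ = p.2 i := rfl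

@[simp]
theorem ofSumTail_symm_apply {n : ℕ} (y : Fin (n + 1) → ℝ) :
    (ofSumTail n).symm y = (∑ i, y i, Fin.tail y) := rfl

@[simp]
theorem sum_ofSumTail {n : ℕ} (p : ℝ × (Fin n → ℝ)) : ∑ i, ofSumTail n p i = p.1 := by
  simp [Fin.sum_univ_succ]

theorem measurePreserving_ofSumTail (n : ℕ) : MeasurePreserving (ofSumTail n) := by
  have hshear : MeasurePreserving
      (fun p : (Fin n → ℝ) × ℝ => (p.1, p.2 - ∑ i, p.1 i)) (volume.prod volume)
      (volume.prod volume) :=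
    (MeasurePreserving.id volume).skew_product (g := fun (z : Fin n → ℝ) t => t - ∑ i, z i)
      (by fun_prop) (ae_of_all _ fun z => (measurePreserving_sub_right volume (∑ i, z i)).map_eq)
  exact (measurePreserving_consCLE n volume).comp
    (Measure.measurePreserving_swap.comp (hshear.comp Measure.measurePreserving_swap))

/-- The point of `ℝⁿ⁺¹` whose coordinates are the barycentric coordinates of `x ∈ ℝⁿ` with respect
to `0, e₁, …, eₙ`. -/
noncomputable def bary {n : ℕ} (x : Fin n → ℝ) : Fin (n + 1) → ℝ := ofSumTail n (1, x)

/-- The interior of `conv(0, e₁, …, eₙ)`, in the coordinate space `Fin n → ℝ`. -/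
def openSimplex (n : ℕ) : Set (Fin n → ℝ) := {x | ∀ i, 0 < bary x i}

@[simp]
theorem sum_bary {n : ℕ} (x : Fin n → ℝ) : ∑ i, bary x i = 1 := sum_ofSumTail _

@[fun_prop]
theorem continuous_bary {n : ℕ} : Continuous (bary (n := n)) :=
  (ofSumTail n).continuous.comp (by fun_prop)

theorem smul_bary {n : ℕ} (s : ℝ) (x : Fin n → ℝ) : s • bary x = ofSumTail n (s, s • x) := by
  rw [bary, ← map_smul]
  simp

theorem isOpen_openSimplex (n : ℕ) : IsOpen (openSimplex n) := by
  simp only [openSimplex, ofPred_forall]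
  exact isOpen_iInter_of_finite fun i => isOpen_lt (by fun_prop) (by fun_prop)

theorem ofSumTail_preimage_orthant (n : ℕ) :
    ofSumTail n ⁻¹' (univ.pi fun _ => Ioi 0) = coneOver (openSimplex n) := by
  ext ⟨s, z⟩
  have hcone (hs : 0 < s) : ofSumTail n (s, z) = s • bary (s⁻¹ • z) := by
    rw [smul_bary, smul_inv_smul₀ hs.ne']
  constructor
  · intro h
    have hpos (i : Fin (n + 1)) : 0 < ofSumTail n (s, z) i := h i (mem_univ i)
    have hs : 0 < s := by
      simpa only [sum_ofSumTail] using
        Finset.sum_pos (fun i _ => hpos i) Finset.univ_nonempty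
    exact ⟨hs, fun i => pos_of_mul_pos_right (by simpa [hcone hs] using hpos i) hs.le⟩
  · rintro ⟨hs, hz⟩ i -
    rw [hcone hs]
    exact mul_pos hs (hz i)

theorem lintegral_pi_expMeasure_eq_cone {n : ℕ} {H : (Fin (n + 1) → ℝ) → ℝ≥0∞} (hH : Measurable H) :
    ∫⁻ y, H y ∂Measure.pi (fun _ => expMeasure 1) =
      ∫⁻ s in Ioi 0, ENNReal.ofReal (s ^ n) *
        ∫⁻ x in openSimplex n, ENNReal.ofReal (Real.exp (-s)) * H (s • bary x) := by
  rw [lintegral_pi_expMeasure hH,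
    ← (measurePreserving_ofSumTail n).setLIntegral_comp_preimage_emb
      (ofSumTail n).toHomeomorph.measurableEmbedding, ofSumTail_preimage_orthant]
  simp only [sum_ofSumTail, smul_bary]
  rw [Measure.volume_eq_prod, setLIntegral_coneOver (isOpen_openSimplex n).measurableSet
    (by fun_prop), Module.finrank_fin_fun]

/- The sum of `n + 1` independent standard exponential variables is Gamma distributed and
independent of their proportions, which are uniform on the simplex. -/
theorem measurePreserving_smul_bary (n : ℕ) :
    MeasurePreserving (fun p : ℝ × (Fin n → ℝ) => p.1 • bary p.2)
      ((gammaMeasure (n + 1) 1).prod ((n.factorial : ℝ≥0∞) • volume.restrict (openSimplex n)))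
      (Measure.pi fun _ => expMeasure 1) := by
  have hpolar : Measurable fun p : ℝ × (Fin n → ℝ) => p.1 • bary p.2 := by fun_prop
  refine ⟨hpolar, Measure.ext_of_lintegral _ fun H hH => ?_⟩
  have hHp : Measurable fun p : ℝ × (Fin n → ℝ) => H (p.1 • bary p.2) := hH.comp hpolar
  rw [lintegral_map hH hpolar, lintegral_prod _ hHp.aemeasurable, gammaMeasure_natCast_add_one,
    lintegral_withDensity_eq_lintegral_mul _ (by fun_prop) (by fun_prop),
    lintegral_pi_expMeasure_eq_cone hH]
  refine setLIntegral_congr_fun measurableSet_Ioi fun s hs => ?_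
  have hs : 0 < s := hs
  have hfac : (n.factorial : ℝ≥0∞) = ENNReal.ofReal n.factorial := by simp
  simp only [Pi.mul_apply, lintegral_smul_measure, smul_eq_mul]
  rw [lintegral_const_mul _ (by fun_prop), hfac, ← mul_assoc, ← mul_assoc,
    ← ENNReal.ofReal_mul (by positivity), ← ENNReal.ofReal_mul (by positivity)]
  congr 2
  field_simp

theorem integral_pi_expMeasure_of_homogeneous (n k : ℕ) {G : (Fin (n + 1) → ℝ) → ℝ}
    {φ : (Fin n → ℝ) → ℝ} (hG : AEStronglyMeasurable G (Measure.pi fun _ => expMeasure 1))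
    (hφ : ∀ᵐ x ∂volume.restrict (openSimplex n), ∀ s : ℝ, 0 < s → G (s • bary x) = s ^ k * φ x) :
    ∫ y, G y ∂(Measure.pi fun _ => expMeasure 1) =
      (n + k).factorial * ∫ x in openSimplex n, φ x := by
  have hpolar := measurePreserving_smul_bary n
  have hpos : ∀ᵐ s ∂gammaMeasure (n + 1) 1, 0 < s := by
    rw [gammaMeasure_natCast_add_one]
    exact (withDensity_absolutelyContinuous _ _).ae_le (ae_restrict_mem measurableSet_Ioi)
  have hfac : (n.factorial : ℝ) ≠ 0 := by positivity
  calc ∫ y, G y ∂(Measure.pi fun _ => expMeasure 1)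
      = ∫ p : ℝ × (Fin n → ℝ), p.1 ^ k * φ p.2 ∂((gammaMeasure (n + 1) 1).prod
          ((n.factorial : ℝ≥0∞) • volume.restrict (openSimplex n))) := by
        rw [← hpolar.map_eq] at hG ⊢
        rw [integral_map hpolar.measurable.aemeasurable hG]
        refine integral_congr_ae ?_
        filter_upwards [Measure.quasiMeasurePreserving_fst.ae hpos,
          Measure.quasiMeasurePreserving_snd.ae (Measure.ae_smul_measure hφ _)] with p hs hp
        exact hp p.1 hs
    _ = (n + k).factorial * ∫ x in openSimplex n, φ x := by
        rw [integral_prod_mul (fun s => s ^ k) φ, integral_pow_gammaMeasure, integral_smul_measure,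
          ENNReal.toReal_natCast, smul_eq_mul]
        field_simp

/-! ### Homogeneous extension -/

section Perspective

variable {E : Type*} [NormedAddCommGroup E] [NormedSpace ℝ E] {g : E → ℝ}

/-- The perspective of `g`: the extension of `g`, placed on the slice `{1} × E`, to a function on
`ℝ × E` that is homogeneous of degree `1`. The value at `(0, z)` is the junk value `0`. -/
noncomputable def perspective (g : E → ℝ) (p : ℝ × E) : ℝ := p.1 * g (p.1⁻¹ • p.2)

theorem perspective_smul {s : ℝ} (hs : s ≠ 0) (x : E) : perspective g (s, s • x) = s * g x := by
  rw [perspective, inv_smul_smul₀ hs]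

theorem abs_mul_sub_mul_le {A : Set E} {L : ℝ≥0} (hg : LipschitzOnWith L g A) {M R : ℝ}
    {x y : E} (hx : x ∈ A) (hy : y ∈ A) (hM : |g x| ≤ M) (hR : ‖x‖ ≤ R) {s t : ℝ} (ht : 0 < t) :
    |s * g x - t * g y| ≤ (M + L * R) * |s - t| + L * ‖s • x - t • y‖ := by
  have hdist : t * ‖x - y‖ ≤ |s - t| * R + ‖s • x - t • y‖ :=
    calc t * ‖x - y‖ = ‖(t - s) • x + (s • x - t • y)‖ := by
          rw [← abs_of_pos ht, ← Real.norm_eq_abs, ← norm_smul, Real.norm_of_nonneg ht.le]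
          congr 1
          module
      _ ≤ |s - t| * ‖x‖ + ‖s • x - t • y‖ := by
          refine (norm_add_le _ _).trans_eq ?_
          rw [norm_smul, Real.norm_eq_abs, abs_sub_comm]
      _ ≤ _ := by gcongr
  calc |s * g x - t * g y| = |(s - t) * g x + t * (g x - g y)| := by ring_nf
    _ ≤ |s - t| * |g x| + t * |g x - g y| := by
        refine (abs_add_le _ _).trans_eq ?_
        rw [abs_mul, abs_mul, abs_of_pos ht]
    _ ≤ |s - t| * M + t * (L * ‖x - y‖) := by
        gcongr
        exact hg.norm_sub_le hx hy
    _ ≤ |s - t| * M + L * (|s - t| * R + ‖s • x - t • y‖) := by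
        rw [mul_left_comm]
        gcongr
    _ = _ := by ring

theorem exists_lipschitzOnWith_perspective {A : Set E} (hA : Bornology.IsBounded A) {L : ℝ≥0}
    (hg : LipschitzOnWith L g A) : ∃ K, LipschitzOnWith K (perspective g) (coneOver A) := by
  obtain ⟨h, hLip, hgh⟩ := hg.extend_real
  obtain ⟨R, hR⟩ := hA.exists_norm_le
  obtain ⟨M, hM⟩ := (hLip.isBounded_image hA).exists_norm_le
  refine ⟨(|M + L * R| + L).toNNReal, .of_dist_le_mul ?_⟩
  rintro ⟨s, z⟩ ⟨hs, hx⟩ ⟨t, w⟩ ⟨ht, hy⟩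
  have hMx : |g (s⁻¹ • z)| ≤ M := hgh hx ▸ hM _ (mem_image_of_mem h hx)
  have hbound := abs_mul_sub_mul_le hg hx hy hMx (hR _ hx) (s := s) ht
  rw [smul_inv_smul₀ hs.ne', smul_inv_smul₀ ht.ne'] at hbound
  rw [Real.coe_toNNReal _ (by positivity), add_mul]
  refine hbound.trans (add_le_add ?_ ?_)
  · gcongr
    · exact le_abs_self _
    · exact le_max_left _ _
  · gcongr
    exact (dist_eq_norm z w).symm.trans_le (le_max_right _ _)

theorem hasFDerivAt_perspective {g' : E →L[ℝ] ℝ} {x : E} (hg : HasFDerivAt g g' x) {s : ℝ}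
    (hs : s ≠ 0) :
    HasFDerivAt (perspective g)
      (g x • ContinuousLinearMap.fst ℝ ℝ E +
        g' ∘L (ContinuousLinearMap.snd ℝ ℝ E - (ContinuousLinearMap.fst ℝ ℝ E).smulRight x))
      (s, s • x) := by
  have hfst : HasFDerivAt (fun p : ℝ × E => p.1) (ContinuousLinearMap.fst ℝ ℝ E) (s, s • x) :=
    hasFDerivAt_fst
  have hinv : HasFDerivAt (fun p : ℝ × E => p.1⁻¹)
      (-(s ^ 2)⁻¹ • ContinuousLinearMap.fst ℝ ℝ E) (s, s • x) :=
    (hasDerivAt_inv hs).comp_hasFDerivAt (s, s • x) hfst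
  have hproj := hinv.fun_smul (hasFDerivAt_snd (𝕜 := ℝ) (p := (s, s • x)))
  have hg' : HasFDerivAt g g' ((s, s • x).1⁻¹ • (s, s • x).2) := by
    rwa [inv_smul_smul₀ hs]
  refine (hfst.fun_mul (hg'.comp (s, s • x) hproj)).congr_fderiv ?_
  ext v
  · simp only [ContinuousLinearMap.comp_add, ContinuousLinearMap.comp_smulₛₗ, map_inv₀,
      Real.ringHom_apply, smul_add, Function.comp_apply, inv_smul_smul₀ hs,
      ContinuousLinearMap.add_comp, ContinuousLinearMap.smul_comp,
      ContinuousLinearMap.fst_comp_inl, add_apply, smul_apply, ContinuousLinearMap.comp_apply,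
      ContinuousLinearMap.inl_apply, ContinuousLinearMap.coe_snd', map_zero, smul_eq_mul, mul_zero,
      ContinuousLinearMap.smulRight_apply, ContinuousLinearMap.coe_fst', mul_one, neg_smul, map_neg,
      map_smul, mul_neg, zero_add, ContinuousLinearMap.id_apply, ContinuousLinearMap.comp_sub,
      ContinuousLinearMap.sub_comp, sub_apply, one_smul, zero_sub]
    field_simp
    ring
  · simp [hs]

end Perspective

theorem smul_bary_mem_orthant {n : ℕ} {x : Fin n → ℝ} (hx : x ∈ openSimplex n) {s : ℝ}
    (hs : 0 < s) : s • bary x ∈ univ.pi fun _ => Ioi 0 :=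
  fun i _ => mul_pos hs (hx i)

theorem bary_le_one {n : ℕ} {x : Fin n → ℝ} (hx : x ∈ openSimplex n) (i : Fin (n + 1)) :
    bary x i ≤ 1 :=
  (Finset.single_le_sum (fun j _ => (hx j).le) (Finset.mem_univ i)).trans_eq (sum_bary x)

theorem isBounded_openSimplex (n : ℕ) : Bornology.IsBounded (openSimplex n) := by
  refine (Metric.isBounded_Icc (0 : Fin n → ℝ) 1).subset fun x hx => ⟨fun i => ?_, fun i => ?_⟩
  · exact (hx i.succ).le
  · exact bary_le_one hx i.succ

/-- The vertices `0, e₁, …, eₙ` of the simplex, in the coordinate space `Fin n → ℝ`. -/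
def vertex {n : ℕ} (i : Fin (n + 1)) : Fin n → ℝ :=
  Fin.tail (Pi.single i 1 : Fin (n + 1) → ℝ)

@[simp]
theorem vertex_zero {n : ℕ} : vertex (0 : Fin (n + 1)) = 0 := by
  ext j
  simp [vertex, Fin.tail]

@[simp]
theorem vertex_succ {n : ℕ} (i : Fin n) : vertex i.succ = Pi.single i 1 := by
  ext j
  simp [vertex, Fin.tail, Pi.single_apply]

theorem sum_bary_smul_vertex {n : ℕ} (x : Fin n → ℝ) : ∑ i, bary x i • vertex i = x := by
  ext j
  simp [Fin.sum_univ_succ, bary, Pi.single_apply]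

/-- The carré du champ `∑ xᵢ (∂ᵢg)² - (∑ xᵢ ∂ᵢg)²` of the simplex: the variance of the derivatives
of `g` towards the vertices, weighted by the barycentric coordinates of `x`. -/
noncomputable def carreDuChamp {n : ℕ} (g : (Fin n → ℝ) → ℝ) (x : Fin n → ℝ) : ℝ :=
  ∑ i, bary x i * lineDeriv ℝ g x (vertex i) ^ 2 -
    (∑ i, bary x i * lineDeriv ℝ g x (vertex i)) ^ 2

theorem sum_mul_add_sub_sq {ι : Type*} {t : Finset ι} {p : ι → ℝ} (hp : ∑ i ∈ t, p i = 1)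
    (δ : ι → ℝ) (c : ℝ) :
    ∑ i ∈ t, p i * (c + (δ i - ∑ j ∈ t, p j * δ j)) ^ 2 =
      c ^ 2 + (∑ i ∈ t, p i * δ i ^ 2 - (∑ i ∈ t, p i * δ i) ^ 2) := by
  generalize hm : ∑ j ∈ t, p j * δ j = m
  calc ∑ i ∈ t, p i * (c + (δ i - m)) ^ 2
      = (c - m) ^ 2 * ∑ i ∈ t, p i + 2 * (c - m) * ∑ i ∈ t, p i * δ i +
          ∑ i ∈ t, p i * δ i ^ 2 := by
        simp only [Finset.mul_sum, ← Finset.sum_add_distrib]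
        exact Finset.sum_congr rfl fun i _ => by ring
    _ = _ := by
        rw [hp, hm]
        ring

theorem exists_lipschitzWith_homogeneous {n : ℕ} {g : (Fin n → ℝ) → ℝ} {L : ℝ≥0}
    (hg : LipschitzOnWith L g (openSimplex n)) :
    ∃ (F : (Fin (n + 1) → ℝ) → ℝ) (K : ℝ≥0), LipschitzWith K F ∧
      EqOn F (perspective g ∘ (ofSumTail n).symm) (univ.pi fun _ => Ioi 0) := by
  obtain ⟨K, hK⟩ := exists_lipschitzOnWith_perspective (isBounded_openSimplex n) hg
  have hcomp : LipschitzOnWith _ (perspective g ∘ (ofSumTail n).symm) (univ.pi fun _ => Ioi 0) :=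
    hK.comp (ofSumTail n).symm.lipschitz.lipschitzOnWith fun y hy => by
      rw [← ofSumTail_preimage_orthant]
      simpa only [mem_preimage, ContinuousLinearEquiv.apply_symm_apply] using hy
  obtain ⟨F, hF, hFg⟩ := hcomp.extend_real
  exact ⟨F, _, hF, hFg.symm⟩

section Homogeneous

variable {n : ℕ} {g : (Fin n → ℝ) → ℝ} {F : (Fin (n + 1) → ℝ) → ℝ} {x : Fin n → ℝ} {s : ℝ}

theorem homogeneous_smul_bary
    (hFg : EqOn F (perspective g ∘ (ofSumTail n).symm) (univ.pi fun _ => Ioi 0))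
    (hx : x ∈ openSimplex n) (hs : 0 < s) :
    F (s • bary x) = s * g x := by
  rw [hFg (smul_bary_mem_orthant hx hs), Function.comp_apply, smul_bary,
    ContinuousLinearEquiv.symm_apply_apply, perspective_smul hs.ne']

theorem lineDeriv_homogeneous
    (hFg : EqOn F (perspective g ∘ (ofSumTail n).symm) (univ.pi fun _ => Ioi 0))
    (hx : x ∈ openSimplex n) (hs : 0 < s)
    (hg : DifferentiableAt ℝ g x) (i : Fin (n + 1)) :
    lineDeriv ℝ F (s • bary x) (Pi.single i 1) =
      g x + (lineDeriv ℝ g x (vertex i) - ∑ j, bary x j * lineDeriv ℝ g x (vertex j)) := by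
  have hnhds : F =ᶠ[𝓝 (s • bary x)] perspective g ∘ (ofSumTail n).symm :=
    hFg.eventuallyEq_of_mem
      ((isOpen_set_pi finite_univ fun _ _ => isOpen_Ioi).mem_nhds (smul_bary_mem_orthant hx hs))
  have hpersp := hasFDerivAt_perspective hg.hasFDerivAt hs.ne'
  have hsymm : (ofSumTail n).symm (s • bary x) = (s, s • x) := by
    rw [smul_bary, ContinuousLinearEquiv.symm_apply_apply]
  rw [← hsymm] at hpersp
  have hmean : fderiv ℝ g x x = ∑ j, bary x j * lineDeriv ℝ g x (vertex j) := by
    conv_lhs => rw [← sum_bary_smul_vertex x, map_sum]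
    simp [hg.lineDeriv_eq_fderiv, sum_bary_smul_vertex]
  rw [hnhds.lineDeriv_eq, (hpersp.comp _ (ofSumTail n).symm.hasFDerivAt).hasLineDerivAt _
    |>.lineDeriv, ← hmean, hg.lineDeriv_eq_fderiv]
  simp [vertex]

theorem sum_mul_lineDeriv_homogeneous_sq
    (hFg : EqOn F (perspective g ∘ (ofSumTail n).symm) (univ.pi fun _ => Ioi 0))
    (hx : x ∈ openSimplex n) (hs : 0 < s)
    (hg : DifferentiableAt ℝ g x) :
    ∑ i, (s • bary x) i * lineDeriv ℝ F (s • bary x) (Pi.single i 1) ^ 2 =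
      s * (g x ^ 2 + carreDuChamp g x) := by
  simp only [lineDeriv_homogeneous hFg hx hs hg, Pi.smul_apply, smul_eq_mul, mul_assoc,
    ← Finset.mul_sum]
  rw [sum_mul_add_sub_sq (sum_bary x), carreDuChamp]

end Homogeneous

theorem integrableOn_carreDuChamp {n : ℕ} {g : (Fin n → ℝ) → ℝ} {L : ℝ≥0} (hg : LipschitzWith L g) :
    IntegrableOn (carreDuChamp g) (openSimplex n) := by
  have hfin : IsFiniteMeasure (volume.restrict (openSimplex n)) :=
    isFiniteMeasure_restrict.2 (isBounded_openSimplex n).measure_lt_top.ne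
  have hbary (p : ℝ≥0∞) (i : Fin (n + 1)) :
      MemLp (fun x => bary x i) p (volume.restrict (openSimplex n)) := by
    refine MemLp.of_bound (by fun_prop) 1 ?_
    filter_upwards [ae_restrict_mem (isOpen_openSimplex n).measurableSet] with x hx
    rw [Real.norm_of_nonneg (hx i).le]
    exact bary_le_one hx i
  have hderiv (i : Fin (n + 1)) : MemLp (fun x => lineDeriv ℝ g x (vertex i)) ∞
      (volume.restrict (openSimplex n)) :=
    MemLp.of_bound (measurable_lineDeriv hg.continuous).aestronglyMeasurable _
      (ae_of_all _ fun _ => norm_lineDeriv_le_of_lipschitz ℝ hg)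
  refine Integrable.sub (integrable_finsetSum _ fun i _ => ?_) (MemLp.integrable_sq ?_)
  · exact integrable_mul_sq_of_norm_le ((hbary 1 i).integrable le_rfl) (hderiv i).1
      fun _ => norm_lineDeriv_le_of_lipschitz ℝ hg
  · exact memLp_finsetSum _ fun i _ => (hderiv i).mul (hbary 2 i)

theorem integral_pi_expMeasure_energy {n : ℕ} {g : (Fin n → ℝ) → ℝ} {L K : ℝ≥0}
    (hg : LipschitzWith L g) {F : (Fin (n + 1) → ℝ) → ℝ} (hF : LipschitzWith K F)
    (hFg : EqOn F (perspective g ∘ (ofSumTail n).symm) (univ.pi fun _ => Ioi 0)) :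
    ∫ y, ∑ i, y i * lineDeriv ℝ F y (Pi.single i 1) ^ 2 ∂(Measure.pi fun _ => expMeasure 1) =
      (n + 1).factorial * ∫ x in openSimplex n, (g x ^ 2 + carreDuChamp g x) := by
  have hint (i : Fin (n + 1)) := integrable_eval_mul_lineDeriv_sq
    (memLp_id_expMeasure.integrable one_le_two) hF i (Pi.single i 1)
  refine integral_pi_expMeasure_of_homogeneous n 1
    (integrable_finsetSum _ fun i _ => hint i).aestronglyMeasurable ?_
  filter_upwards [ae_restrict_mem (isOpen_openSimplex n).measurableSet,
    ae_restrict_of_ae hg.ae_differentiableAt] with x hx hdiff s hs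
  rw [sum_mul_lineDeriv_homogeneous_sq hFg hx hs hdiff, pow_one]

theorem poincare_openSimplex_of_lipschitzWith {n : ℕ} {g : (Fin n → ℝ) → ℝ} {L : ℝ≥0}
    (hg : LipschitzWith L g) (h0 : ∫ x in openSimplex n, g x = 0) :
    ∫ x in openSimplex n, g x ^ 2 ≤
      1 / ((n : ℝ) + 1) * ∫ x in openSimplex n, carreDuChamp g x := by
  obtain ⟨F, K, hF, hFg⟩ := exists_lipschitzWith_homogeneous hg.lipschitzOnWith
  have hmem := ae_restrict_mem (μ := volume) (isOpen_openSimplex n).measurableSet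
  have hmean : ∫ y, F y ∂(Measure.pi fun _ => expMeasure 1) = 0 := by
    rw [integral_pi_expMeasure_of_homogeneous n 1 (φ := g) hF.continuous.aestronglyMeasurable, h0,
      mul_zero]
    filter_upwards [hmem] with x hx s hs
    rw [homogeneous_smul_bary hFg hx hs, pow_one]
  have hsq : ∫ y, F y ^ 2 ∂(Measure.pi fun _ => expMeasure 1) =
      (n + 2).factorial * ∫ x in openSimplex n, g x ^ 2 := by
    refine integral_pi_expMeasure_of_homogeneous n 2 (hF.continuous.pow 2).aestronglyMeasurable ?_
    filter_upwards [hmem] with x hx s hs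
    rw [homogeneous_smul_bary hFg hx hs, mul_pow]
  have hg2 : IntegrableOn (fun x => g x ^ 2) (openSimplex n) :=
    ((hg.continuous.pow 2).continuousOn.integrableOn_compact
      (isBounded_openSimplex n).isCompact_closure).mono_set subset_closure
  have hvar := variance_pi_expMeasure_le hF
  rw [variance_of_integral_eq_zero hF.continuous.aemeasurable hmean, hsq,
    integral_pi_expMeasure_energy hg hF hFg, integral_add hg2 (integrableOn_carreDuChamp hg),
    Nat.factorial_succ (n + 1), mul_comm (n + 1 + 1), Nat.cast_mul, mul_assoc] at hvar
  have hle := le_of_mul_le_mul_left hvar (by positivity)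
  push_cast at hle
  rw [one_div_mul_eq_div, le_div_iff₀ (by positivity)]
  linarith

theorem carreDuChamp_congr {n : ℕ} {g h : (Fin n → ℝ) → ℝ} {x : Fin n → ℝ} (hgh : g =ᶠ[𝓝 x] h) :
    carreDuChamp g x = carreDuChamp h x := by
  simp only [carreDuChamp, hgh.lineDeriv_eq]

theorem poincare_openSimplex {n : ℕ} {g : (Fin n → ℝ) → ℝ} {L : ℝ≥0}
    (hg : LipschitzOnWith L g (openSimplex n)) (h0 : ∫ x in openSimplex n, g x = 0) :
    ∫ x in openSimplex n, g x ^ 2 ≤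
      1 / ((n : ℝ) + 1) * ∫ x in openSimplex n, carreDuChamp g x := by
  obtain ⟨h, hLip, hgh⟩ := hg.extend_real
  have hopen := isOpen_openSimplex n
  have hcdc : EqOn (carreDuChamp g) (carreDuChamp h) (openSimplex n) := fun x hx =>
    carreDuChamp_congr (hgh.eventuallyEq_of_mem (hopen.mem_nhds hx))
  have hsq : EqOn (fun x => g x ^ 2) (fun x => h x ^ 2) (openSimplex n) := fun x hx =>
    congrArg (· ^ 2) (hgh hx)
  rw [setIntegral_congr_fun hopen.measurableSet hgh] at h0
  rw [setIntegral_congr_fun hopen.measurableSet hcdc,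
    setIntegral_congr_fun hopen.measurableSet hsq]
  exact poincare_openSimplex_of_lipschitzWith hLip h0

/-! ### The solid simplex -/

@[simp]
theorem bary_vertex {n : ℕ} (i : Fin (n + 1)) : bary (vertex i) = Pi.single i 1 := by
  rw [bary, ← ContinuousLinearEquiv.eq_symm_apply]
  simp [vertex]

theorem bary_combo {n : ℕ} {a b : ℝ} (hab : a + b = 1) (x y : Fin n → ℝ) :
    bary (a • x + b • y) = a • bary x + b • bary y := by
  simp only [bary, ← map_smul, ← map_add, Prod.smul_mk, Prod.mk_add_mk, smul_eq_mul, mul_one, hab]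

theorem convex_openSimplex (n : ℕ) : Convex ℝ (openSimplex n) :=
  fun x hx y hy a b ha hb hab i => by
    rw [bary_combo hab]
    exact convex_Ioi (0 : ℝ) (hx i) (hy i) ha hb hab

theorem mem_closure_openSimplex {n : ℕ} {x : Fin n → ℝ} (hx : ∀ i, 0 ≤ bary x i) :
    x ∈ closure (openSimplex n) := by
  let c : Fin n → ℝ := ((ofSumTail n).symm fun _ => ((n : ℝ) + 1)⁻¹).2
  have hc (i : Fin (n + 1)) : 0 < bary c i := by
    have hbary : bary c = fun _ => ((n : ℝ) + 1)⁻¹ := by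
      rw [bary, ← ContinuousLinearEquiv.eq_symm_apply]
      have hn : (n : ℝ) + 1 ≠ 0 := by positivity
      ext <;> simp [c, mul_inv_cancel₀ hn]
    simpa only [hbary] using Nat.inv_pos_of_nat
  have hsub : openSegment ℝ x c ⊆ openSimplex n := by
    rintro _ ⟨a, b, ha, hb, hab, rfl⟩ i
    rw [bary_combo hab]
    exact add_pos_of_nonneg_of_pos (mul_nonneg ha.le (hx i)) (mul_pos hb (hc i))
  exact closure_mono hsub (segment_subset_closure_openSegment (left_mem_segment ℝ x c))

theorem solidSimplex_eq_convexHull_vertex (n : ℕ) :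
    solidSimplex n = convexHull ℝ (range fun i : Fin (n + 1) => WithLp.toLp 2 (vertex i)) := by
  rw [solidSimplex, Fin.range_fin_succ]
  simp [Fin.tail_def]

theorem toLp_mem_solidSimplex {n : ℕ} {x : Fin n → ℝ} (hx : x ∈ openSimplex n) :
    WithLp.toLp 2 x ∈ solidSimplex n := by
  have hsum : WithLp.toLp 2 x = ∑ i, bary x i • WithLp.toLp 2 (vertex i) := by
    simp only [← WithLp.toLp_smul, ← WithLp.toLp_sum, sum_bary_smul_vertex]
  rw [hsum, solidSimplex_eq_convexHull_vertex]
  exact (convex_convexHull ℝ _).sum_mem (fun i _ => (hx i).le) (sum_bary x)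
    fun i _ => subset_convexHull ℝ _ (mem_range_self i)

theorem bary_nonneg_of_mem_solidSimplex {n : ℕ} {x : EuclideanSpace ℝ (Fin n)}
    (hx : x ∈ solidSimplex n) (i : Fin (n + 1)) : 0 ≤ bary x.ofLp i := by
  rw [solidSimplex_eq_convexHull_vertex] at hx
  refine convexHull_min (t := {x | 0 ≤ bary x.ofLp i}) ?_ (fun x hx y hy a b ha hb hab => ?_) hx
  · rintro _ ⟨j, rfl⟩
    simp only [mem_ofPred_eq, bary_vertex]
    exact (Pi.single_nonneg (α := fun _ => ℝ)).2 zero_le_one i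
  · simp only [mem_ofPred_eq, WithLp.ofLp_add, WithLp.ofLp_smul, bary_combo hab]
    exact convex_Ici (0 : ℝ) hx hy ha hb hab

theorem openSimplex_ae_eq_preimage_solidSimplex (n : ℕ) :
    openSimplex n =ᵐ[volume] WithLp.toLp 2 ⁻¹' solidSimplex n := by
  refine EventuallyLE.antisymm
    (LE.le.eventuallyLE fun x hx => toLp_mem_solidSimplex hx)
    (ae_le_set.2 (measure_mono_null ?_ ((convex_openSimplex n).addHaar_frontier volume)))
  rw [(isOpen_openSimplex n).frontier_eq]
  exact sdiff_subset_sdiff_left fun x hx =>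
    mem_closure_openSimplex (bary_nonneg_of_mem_solidSimplex hx)

theorem setIntegral_solidSimplex (n : ℕ) (φ : EuclideanSpace ℝ (Fin n) → ℝ) :
    ∫ x in solidSimplex n, φ x = ∫ x in openSimplex n, φ (WithLp.toLp 2 x) := by
  rw [setIntegral_congr_set (openSimplex_ae_eq_preimage_solidSimplex n)]
  exact ((PiLp.volume_preserving_toLp (Fin n)).setIntegral_preimage_emb
    (MeasurableEquiv.toLp 2 (Fin n → ℝ)).measurableEmbedding φ _).symm

theorem carreDuChamp_comp_toLp {n : ℕ} (f : EuclideanSpace ℝ (Fin n) → ℝ) (x : Fin n → ℝ) :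
    carreDuChamp (fun y => f (WithLp.toLp 2 y)) x =
      ∑ i, x i * |partialDeriv i f (WithLp.toLp 2 x)| ^ 2 -
        (∑ i, x i * partialDeriv i f (WithLp.toLp 2 x)) ^ 2 := by
  have hderiv (i : Fin n) : lineDeriv ℝ (fun y => f (WithLp.toLp 2 y)) x (Pi.single i 1) =
      partialDeriv i f (WithLp.toLp 2 x) := rfl
  simp [carreDuChamp, Fin.sum_univ_succ, hderiv, bary, lineDeriv_zero]

theorem poincare_solidSimplex {n : ℕ} {f : EuclideanSpace ℝ (Fin n) → ℝ} {L : ℝ≥0}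
    (hf : LipschitzOnWith L f (solidSimplex n)) (h0 : ∫ x in solidSimplex n, f x = 0) :
    ∫ x in solidSimplex n, f x ^ 2 ≤
      1 / ((n : ℝ) + 1) * ∫ x in solidSimplex n,
        ((∑ i, x i * |partialDeriv i f x| ^ 2) - (∑ i, x i * partialDeriv i f x) ^ 2) := by
  have hg : LipschitzOnWith _ (fun x => f (WithLp.toLp 2 x)) (openSimplex n) :=
    hf.comp (PiLp.lipschitzWith_toLp 2 fun _ : Fin n => ℝ).lipschitzOnWith
      fun _ => toLp_mem_solidSimplex
  rw [setIntegral_solidSimplex] at h0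
  simpa only [setIntegral_solidSimplex, ← carreDuChamp_comp_toLp] using poincare_openSimplex hg h0

/-! ### The regular simplex -/

section Hausdorff

variable {U V : Type*} [NormedAddCommGroup U] [InnerProductSpace ℝ U] [FiniteDimensional ℝ U]
  [MeasurableSpace U] [BorelSpace U] [NormedAddCommGroup V] [InnerProductSpace ℝ V]
  [MeasurableSpace V] [BorelSpace V] {f : U →ₗ[ℝ] V}

theorem measurableEmbedding_const_add (hf : Function.Injective f) (b : V) :
    MeasurableEmbedding fun x => b + f x :=
  (Homeomorph.addLeft b).measurableEmbedding.comp
    (f.isClosedEmbedding_of_injective (LinearMap.ker_eq_bot.2 hf)).measurableEmbedding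

theorem comap_const_add_euclideanHausdorffMeasure (hf : Function.Injective f) (b : V) :
    (μHE[Module.finrank ℝ U]).comap (fun x => b + f x) = ENNReal.ofReal f.normDet • volume := by
  refine Measure.ext fun s _ => ?_
  have himage : (fun x => b + f x) '' s = (-b + ·) ⁻¹' (f '' s) := by
    rw [← image_image (b + ·) f, image_add_left]
  rw [(measurableEmbedding_const_add hf b).comap_apply, himage, measure_preimage_add,
    f.euclideanHausdorffMeasure_image_eq_normDet_mul_volume]
  rfl

theorem setIntegral_image_euclideanHausdorffMeasure (hf : Function.Injective f) (b : V) (s : Set U)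
    (φ : V → ℝ) :
    ∫ p in (fun x => b + f x) '' s, φ p ∂μHE[Module.finrank ℝ U] =
      f.normDet * ∫ x in s, φ (b + f x) := by
  have hemb := measurableEmbedding_const_add hf b
  have hmap := hemb.setIntegral_map (μ := (μHE[Module.finrank ℝ U]).comap fun x => b + f x) φ
    ((fun x => b + f x) '' s)
  rwa [hemb.map_comap, Measure.restrict_restrict_of_subset (image_subset_range _ _),
    preimage_image_eq _ hemb.injective, comap_const_add_euclideanHausdorffMeasure hf,
    Measure.restrict_smul, integral_smul_measure,
    ENNReal.toReal_ofReal f.normDet_nonneg] at hmap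

end Hausdorff

/-- The linear part of the parametrization `x ↦ bary x` of the hyperplane of the regular simplex,
between Euclidean spaces. -/
noncomputable def baryLinear (n : ℕ) :
    EuclideanSpace ℝ (Fin n) →ₗ[ℝ] EuclideanSpace ℝ (Fin (n + 1)) :=
  (WithLp.linearEquiv 2 ℝ _).symm.toLinearMap ∘ₗ (ofSumTail n).toLinearMap ∘ₗ
    LinearMap.inr ℝ ℝ (Fin n → ℝ) ∘ₗ (WithLp.linearEquiv 2 ℝ _).toLinearMap

theorem injective_baryLinear (n : ℕ) : Function.Injective (baryLinear n) :=
  (WithLp.linearEquiv 2 ℝ _).symm.injective.comp <| (ofSumTail n).injective.comp <|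
    LinearMap.inr_injective.comp (WithLp.linearEquiv 2 ℝ _).injective

theorem toLp_bary_zero_add {n : ℕ} (x : Fin n → ℝ) :
    WithLp.toLp 2 (bary 0) + baryLinear n (WithLp.toLp 2 x) = WithLp.toLp 2 (bary x) := by
  have hbary : bary x = bary 0 + ofSumTail n (0, x) := by
    simp only [bary, ← map_add, Prod.mk_add_mk, add_zero, zero_add]
  rw [hbary]
  rfl

theorem lipschitzWith_bary (n : ℕ) :
    LipschitzWith ‖(ofSumTail n : ℝ × (Fin n → ℝ) →L[ℝ] Fin (n + 1) → ℝ)‖₊ (bary (n := n)) := by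
  have hcomp := (ofSumTail n).lipschitz.comp (LipschitzWith.prodMk_left (1 : ℝ))
  rwa [mul_one] at hcomp

theorem image_toLp_bary (n : ℕ) :
    (fun x => WithLp.toLp 2 (bary x)) '' openSimplex n = regularSimplex n := by
  ext p
  constructor
  · rintro ⟨x, hx, rfl⟩
    exact ⟨hx, sum_bary x⟩
  · rintro ⟨hpos, hsum⟩
    have hbary : bary (Fin.tail p.ofLp) = p.ofLp := by
      rw [bary, ← ContinuousLinearEquiv.eq_symm_apply, ofSumTail_symm_apply, hsum]
    exact ⟨Fin.tail p.ofLp, by simpa only [openSimplex, mem_ofPred_eq, hbary], by simp only [hbary]⟩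

theorem setIntegral_regularSimplex (n : ℕ) (φ : EuclideanSpace ℝ (Fin (n + 1)) → ℝ) :
    ∫ p in regularSimplex n, φ p ∂μHE[n] =
      (baryLinear n).normDet * ∫ x in openSimplex n, φ (WithLp.toLp 2 (bary x)) := by
  have himage : (fun x => WithLp.toLp 2 (bary 0) + baryLinear n x) ''
      (WithLp.toLp 2 '' openSimplex n) = regularSimplex n := by
    simp only [image_image, toLp_bary_zero_add, image_toLp_bary]
  have hint := setIntegral_image_euclideanHausdorffMeasure (injective_baryLinear n)
    (WithLp.toLp 2 (bary 0)) (WithLp.toLp 2 '' openSimplex n) φ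
  rw [himage, finrank_euclideanSpace_fin] at hint
  rw [hint, (PiLp.volume_preserving_toLp (Fin n)).setIntegral_image_emb
    (MeasurableEquiv.toLp 2 (Fin n → ℝ)).measurableEmbedding]
  simp only [toLp_bary_zero_add]

theorem tangentDeriv_toLp_bary {n : ℕ} (f : EuclideanSpace ℝ (Fin (n + 1)) → ℝ) (x : Fin n → ℝ)
    (i j : Fin (n + 1)) :
    tangentDeriv i j f (WithLp.toLp 2 (bary x)) =
      lineDeriv ℝ (fun y => f (WithLp.toLp 2 (bary y))) x (vertex i - vertex j) := by
  have hline (t : ℝ) : bary (x + t • (vertex i - vertex j)) =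
      bary x + t • (Pi.single i 1 - Pi.single j 1) := by
    simp only [← bary_vertex, bary, ← map_sub, ← map_smul, ← map_add]
    simp
  simp only [tangentDeriv, lineDeriv, hline]
  rfl

theorem sum_Ioi_mul_sub_sq {ι : Type*} [Fintype ι] [LinearOrder ι] [LocallyFiniteOrderTop ι]
    [LocallyFiniteOrderBot ι] (p δ : ι → ℝ) :
    ∑ i, ∑ j ∈ Finset.Ioi i, p i * p j * (δ i - δ j) ^ 2 =
      (∑ i, p i) * (∑ i, p i * δ i ^ 2) - (∑ i, p i * δ i) ^ 2 := by
  have hoff (i : ι) : ∑ j ∈ {i}ᶜ, p j * p i * (δ j - δ i) ^ 2 =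
      ∑ j, p j * p i * (δ j - δ i) ^ 2 :=
    Finset.sum_subset (Finset.subset_univ _) fun j _ hj => by simp_all
  have hsymm (i j : ι) : p j * p i * (δ j - δ i) ^ 2 + p i * p j * (δ i - δ j) ^ 2 =
      2 * (p i * p j * (δ i - δ j) ^ 2) := by ring
  have hexpand (i j : ι) : p j * p i * (δ j - δ i) ^ 2 =
      p i * (p j * δ j ^ 2) + p i * δ i ^ 2 * p j - 2 * (p i * δ i * (p j * δ j)) := by ring
  have hdouble : 2 * ∑ i, ∑ j ∈ Finset.Ioi i, p i * p j * (δ i - δ j) ^ 2 =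
      ∑ i, ∑ j, p j * p i * (δ j - δ i) ^ 2 := by
    have hadd := Finset.sum_sum_Ioi_add_eq_sum_sum_off_diag
      fun i j : ι => p i * p j * (δ i - δ j) ^ 2
    simpa only [hoff, hsymm, ← Finset.mul_sum] using hadd
  have hfull : ∑ i, ∑ j, p j * p i * (δ j - δ i) ^ 2 =
      2 * ((∑ i, p i) * (∑ i, p i * δ i ^ 2) - (∑ i, p i * δ i) ^ 2) := by
    simp only [hexpand, Finset.sum_sub_distrib, Finset.sum_add_distrib, ← Finset.mul_sum,
      ← Finset.sum_mul]
    ring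
  linarith

theorem sum_Ioi_bary_mul_tangentDeriv_sq {n : ℕ} {f : EuclideanSpace ℝ (Fin (n + 1)) → ℝ}
    {x : Fin n → ℝ} (hf : DifferentiableAt ℝ (fun y => f (WithLp.toLp 2 (bary y))) x) :
    ∑ i, ∑ j ∈ Finset.Ioi i,
        bary x i * bary x j * |tangentDeriv i j f (WithLp.toLp 2 (bary x))| ^ 2 =
      carreDuChamp (fun y => f (WithLp.toLp 2 (bary y))) x := by
  simp only [sq_abs, tangentDeriv_toLp_bary, carreDuChamp, hf.lineDeriv_eq_fderiv, map_sub,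
    sum_Ioi_mul_sub_sq, sum_bary, one_mul]

theorem poincare_regularSimplex {n : ℕ} {f : EuclideanSpace ℝ (Fin (n + 1)) → ℝ} {L : ℝ≥0}
    (hf : LipschitzOnWith L f (regularSimplex n))
    (h0 : ∫ x in regularSimplex n, f x ∂μHE[n] = 0) :
    ∫ x in regularSimplex n, f x ^ 2 ∂μHE[n] ≤
      1 / ((n : ℝ) + 1) * ∫ x in regularSimplex n,
        (∑ i : Fin (n + 1), ∑ j ∈ Finset.Ioi i,
          x i * x j * |tangentDeriv i j f x| ^ 2) ∂μHE[n] := by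
  have hopen := isOpen_openSimplex n
  have hdet : (baryLinear n).normDet ≠ 0 :=
    ((baryLinear n).normDet_ne_zero_tfae.out 0 1).2
      (LinearMap.ker_eq_bot.2 (injective_baryLinear n))
  have hg : LipschitzOnWith _ (fun x => f (WithLp.toLp 2 (bary x))) (openSimplex n) :=
    hf.comp ((PiLp.lipschitzWith_toLp 2 fun _ : Fin (n + 1) => ℝ).comp
      (lipschitzWith_bary n)).lipschitzOnWith
        ((mapsTo_image _ _).mono_right (image_toLp_bary n).subset)
  have henergy : ∫ x in openSimplex n, ∑ i, ∑ j ∈ Finset.Ioi i,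
      bary x i * bary x j * |tangentDeriv i j f (WithLp.toLp 2 (bary x))| ^ 2 =
        ∫ x in openSimplex n, carreDuChamp (fun y => f (WithLp.toLp 2 (bary y))) x := by
    refine setIntegral_congr_ae hopen.measurableSet ?_
    filter_upwards [hg.ae_differentiableWithinAt_of_mem] with x hdiff hx
    exact sum_Ioi_bary_mul_tangentDeriv_sq ((hdiff hx).differentiableAt (hopen.mem_nhds hx))
  rw [setIntegral_regularSimplex, mul_eq_zero_iff_left hdet] at h0
  rw [setIntegral_regularSimplex, setIntegral_regularSimplex, henergy, mul_left_comm]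
  gcongr
  · exact LinearMap.normDet_nonneg _
  · exact poincare_openSimplex hg h0

end SimplexPoincare

theorem corollary4p4 (n : ℕ) (hn : 1 ≤ n) :
    (∀ f : EuclideanSpace ℝ (Fin n) → ℝ,
      (∃ L, LipschitzOnWith L f (solidSimplex n)) →
      ∫ x in solidSimplex n, f x = 0 →
      ∫ x in solidSimplex n, f x ^ 2 ≤
        1 / ((n : ℝ) + 1) * ∫ x in solidSimplex n,
          ((∑ i, x i * |partialDeriv i f x| ^ 2) - (∑ i, x i * partialDeriv i f x) ^ 2)) ∧
    (∀ f : EuclideanSpace ℝ (Fin (n + 1)) → ℝ,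
      (∃ L, LipschitzOnWith L f (regularSimplex n)) →
      ∫ x in regularSimplex n, f x ∂μHE[n] = 0 →
      ∫ x in regularSimplex n, f x ^ 2 ∂μHE[n] ≤
        1 / ((n : ℝ) + 1) * ∫ x in regularSimplex n,
          (∑ i : Fin (n + 1), ∑ j ∈ Finset.Ioi i,
            x i * x j * |tangentDeriv i j f x| ^ 2) ∂μHE[n]) :=
  ⟨fun _ ⟨_, hf⟩ h0 => SimplexPoincare.poincare_solidSimplex hf h0,
    fun _ ⟨_, hf⟩ h0 => SimplexPoincare.poincare_regularSimplex hf h0⟩
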